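/- For a matroid $M$ on a finite ground set $E$ and a field $K$, say that $M$ is representable over $K$ if there is a matrix over $K$ with columns indexed by $E$ such that a subset of $E$ is independent in $M$ if and only if the corresponding columns are linearly independent; $M$ is representable if it is representable over some field. For a representable matroid $M$, let $c(M)$ be the least positive characteristic of a field over which $M$ is representable. For each positive integer $n$, let \[ c(n) = \max\{\, c(M) : M \text{ is a representable matroid on } n \text{ elements} \,\}. \] Then, for every positive integer $n$, \[ \log_2 c(n) \ge \frac{n-7}{2}. \] -/

import Mathlib

universe u

/-- `M` is representable over the field `K`: there is a matrix over `K`, with columns `v e`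
indexed by the elements of `M`, such that the independent sets of `M` are exactly the sets of
elements whose (indexed) families of columns are linearly independent. -/
def MatroidRepresentableOver {α : Type*} (M : Matroid α) (K : Type*) [Field K] : Prop :=
  ∃ (r : ℕ) (v : α → (Fin r → K)), ∀ I ⊆ M.E, (M.Indep I ↔ LinearIndepOn K v I)

/-- `M` is representable over some field. -/
def MatroidRepresentable {α : Type*} (M : Matroid α) : Prop :=
  ∃ (K : Type u) (_ : Field K), MatroidRepresentableOver M K

/-- The positive characteristics of the fields over which `M` is representable. -/
def positiveCharSet {α : Type*} (M : Matroid α) : Set ℕ :=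
  {p | 0 < p ∧ ∃ (K : Type u) (_ : Field K), CharP K p ∧ MatroidRepresentableOver M K}

/-- `c(M)`: the least positive characteristic of a field over which `M` is representable.
(If there were none, the value would be `0`, which can only lower the maximum below.) -/
noncomputable def leastPosChar {α : Type*} (M : Matroid α) : ℕ :=
  sInf (positiveCharSet.{u} M)

/-- The values `c(M)`, for `M` a representable matroid on `n` elements. -/
def leastPosCharValues (n : ℕ) : Set ℕ :=
  {c | ∃ M : Matroid (Fin n), M.E = Set.univ ∧ MatroidRepresentable.{u} M ∧
    leastPosChar.{u} M = c}

/-- `c(n)`: the maximum of `c(M)` over the representable matroids `M` on `n` elements. -/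
noncomputable def maxLeastPosChar (n : ℕ) : ℕ :=
  sSup (leastPosCharValues.{u} n)

/-- The supremum defining `c(n)` is a genuine maximum. -/
theorem isGreatest_maxLeastPosChar (n : ℕ) :
    IsGreatest (leastPosCharValues.{u} n) (maxLeastPosChar.{u} n) := by
  have hfin : Finite (Matroid (Fin n)) := by
    refine Finite.of_injective
      (fun M : Matroid (Fin n) => (M.E, {I : Set (Fin n) | M.Indep I})) ?_
    intro M N h
    simp only [Prod.mk.injEq] at h
    refine Matroid.ext_indep h.1 fun I _ => ?_
    exact Set.ext_iff.mp h.2 I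
  have hbdd : (leastPosCharValues.{u} n).Finite := by
    refine (Set.finite_range fun M : Matroid (Fin n) => leastPosChar.{u} M).subset ?_
    rintro c ⟨M, -, -, rfl⟩
    exact ⟨M, rfl⟩
  have hne : (leastPosCharValues.{u} n).Nonempty := by
    refine ⟨_, Matroid.loopyOn Set.univ, rfl,
      ⟨ULift.{u} ℚ, inferInstance, 0, fun _ => 0, fun I _ => ?_⟩, rfl⟩
    rw [Matroid.loopyOn_indep_iff]
    constructor
    · rintro rfl
      exact linearIndepOn_empty _ _
    · intro h
      by_contra hI
      obtain ⟨e, he⟩ := Set.nonempty_iff_ne_empty.mpr hI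
      exact h.ne_zero he rfl
  exact ⟨Nat.sSup_mem hne hbdd.bddAbove, fun c hc => le_csSup hbdd.bddAbove hc⟩

/-!
Over `ZMod p`, von Staudt's constructions build a planar point configuration that starts from a
projective frame and reaches abscissa `p + 1` by reading the binary digits of `p + 1`, at a cost of
two points per digit: doubling is a projection from a fixed centre, adding one is a translation
along the diagonal direction. Over `ZMod p` the point of abscissa `p + 1` lies on the line `x = 1`.
A representation over another field `K` of the matroid of this configuration can be normalized on
the frame; the collinearities then force the same abscissae in `K`, and the final coincidence reads
`p + 1 = 1`, so `K` has characteristic `p`. By Bertrand's postulate `p` can be chosen with a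
prescribed number of digits, that is, exponential in half the number of points.
-/

open Module Submodule

section MatroidEquiv

variable {ι κ F K V W : Type*} [Field F] [Field K] [AddCommGroup V] [Module F V]
  [AddCommGroup W] [Module K W]

variable (F K) in
/-- Two families of vectors, possibly over different fields, represent the same matroid on their
common index type. -/
def MatroidEquiv (w : ι → V) (v : ι → W) : Prop :=
  ∀ I : Set ι, LinearIndepOn F w I ↔ LinearIndepOn K v I

namespace MatroidEquiv

variable {w : ι → V} {v : ι → W}

theorem comp {ι' : Type*} (h : MatroidEquiv F K w v) {g : ι' → ι} (hg : g.Injective) :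
    MatroidEquiv F K (w ∘ g) (v ∘ g) := fun I =>
  calc LinearIndepOn F (w ∘ g) I
      ↔ LinearIndepOn F w (g '' I) := ⟨.image_of_comp g w, (·.comp_of_image hg.injOn)⟩
    _ ↔ LinearIndepOn K v (g '' I) := h _
    _ ↔ LinearIndepOn K (v ∘ g) I := ⟨(·.comp_of_image hg.injOn), .image_of_comp g v⟩

theorem linearIndependent_comp_iff (h : MatroidEquiv F K w v) (f : κ → ι) :
    LinearIndependent F (w ∘ f) ↔ LinearIndependent K (v ∘ f) := by
  by_cases hf : f.Injective
  · rw [← linearIndepOn_range_iff hf, ← linearIndepOn_range_iff hf, h]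
  · exact iff_of_false (fun hw => hf hw.injective.of_comp) (fun hv => hf hv.injective.of_comp)

theorem mem_span_image_iff (h : MatroidEquiv F K w v) {I : Set ι} (hI : LinearIndepOn F w I)
    (i : ι) : w i ∈ span F (w '' I) ↔ v i ∈ span K (v '' I) := by
  rw [hI.mem_span_iff, ((h I).1 hI).mem_span_iff, h]

theorem repr_eq_zero_iff (h : MatroidEquiv F K w v) {e : κ → ι} (b : Basis κ F V)
    (c : Basis κ K W) (hb : ∀ k, w (e k) = b k) (hc : ∀ k, v (e k) = c k) (i : ι) (k : κ) :
    b.repr (w i) k = 0 ↔ c.repr (v i) k = 0 := by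
  have hb' : w '' (e '' {k}ᶜ) = b '' {k}ᶜ := by simp only [Set.image_image, hb]
  have hc' : v '' (e '' {k}ᶜ) = c '' {k}ᶜ := by simp only [Set.image_image, hc]
  have hI : LinearIndepOn F w (e '' {k}ᶜ) :=
    .image_of_comp e w (by simpa only [Function.comp_def, hb] using b.linearIndepOn {k}ᶜ)
  simpa [hb', hc', Basis.mem_span_image] using h.mem_span_image_iff hI i

theorem exists_coordinates [Finite κ] [DecidableEq κ] (h : MatroidEquiv F K w v) {e : κ → ι}
    (b : Basis κ F V) (hb : ∀ k, w (e k) = b k) :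
    ∃ v' : ι → κ → K, MatroidEquiv F K w v' ∧ ∀ k, v' (e k) = Pi.single k 1 := by
  have hwe : LinearIndependent F (w ∘ e) := by
    simpa only [Function.comp_def, hb] using b.linearIndependent
  have hve : LinearIndependent K (v ∘ e) := (h.linearIndependent_comp_iff e).1 hwe
  have hmem : ∀ i, v i ∈ span K (Set.range (v ∘ e)) := fun i => by
    rw [Set.range_comp, ← h.mem_span_image_iff
      ((linearIndepOn_range_iff hwe.injective.of_comp w).2 hwe), ← Set.range_comp]
    simpa only [Function.comp_def, hb, b.span_eq] using mem_top
  let c := (Basis.span hve).equivFun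
  let T : (κ → K) →ₗ[K] W := (span K (Set.range (v ∘ e))).subtype ∘ₗ c.symm.toLinearMap
  have hT : Function.Injective T := Subtype.val_injective.comp c.symm.injective
  let v' : ι → κ → K := fun i => c ⟨v i, hmem i⟩
  have hTv : T ∘ v' = v := by ext i; simp [T, v']
  refine ⟨v', fun I => ?_, fun k => hT ?_⟩
  · rw [h, ← hTv]
    exact T.linearIndepOn_iff_of_injOn hT.injOn
  · rw [← Function.comp_apply (f := T), hTv]
    simp [T, c, Basis.span_apply]

theorem smul_units (h : MatroidEquiv F K w v) (s : ι → Kˣ) :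
    MatroidEquiv F K w (s • v) := fun I =>
  (h I).trans (LinearIndependent.units_smul_iff _ fun i : I => s i).symm

theorem map_linearEquiv {W' : Type*} [AddCommGroup W'] [Module K W'] (h : MatroidEquiv F K w v)
    (T : W ≃ₗ[K] W') : MatroidEquiv F K w (T ∘ v) := fun I =>
  (h I).trans (T.toLinearMap.linearIndepOn_iff_of_injOn T.injective.injOn).symm

theorem det_eq_zero_iff [Fintype κ] [DecidableEq κ] {w : ι → κ → F} {v : ι → κ → K}
    (h : MatroidEquiv F K w v) (f : κ → ι) :
    (Matrix.of (w ∘ f)).det = 0 ↔ (Matrix.of (v ∘ f)).det = 0 := by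
  have key := h.linearIndependent_comp_iff f
  rw [← not_iff_not, ← ne_eq, ← ne_eq, ← isUnit_iff_ne_zero, ← isUnit_iff_ne_zero,
    ← Matrix.isUnit_iff_isUnit_det, ← Matrix.isUnit_iff_isUnit_det,
    ← Matrix.linearIndependent_rows_iff_isUnit, ← Matrix.linearIndependent_rows_iff_isUnit]
  exact key

end MatroidEquiv

/-- The family `v` represents the same matroid as `w`, in homogeneous coordinates adapted to the
standard projective frame: the coordinate hyperplanes are the same for `v` and for `w`, the point
`u` is the unit point, and the points of the affine chart `x k₀ ≠ 0` are scaled to `x k₀ = 1`. -/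
structure IsNormalizedRep (k₀ : κ) (u : ι) (w : ι → κ → F) (v : ι → κ → K) : Prop where
  matroidEquiv : MatroidEquiv F K w v
  eq_zero_iff : ∀ i k, v i k = 0 ↔ w i k = 0
  eq_one : ∀ i, w i k₀ ≠ 0 → v i k₀ = 1
  unit_eq_one : v u = 1

theorem MatroidEquiv.exists_isNormalizedRep [Finite κ] [DecidableEq κ] {w : ι → κ → F}
    {v : ι → W} (h : MatroidEquiv F K w v) {e : κ → ι} (he : ∀ k, w (e k) = Pi.single k 1) (k₀ : κ)
    {u : ι} (hu : w u = 1) : ∃ v' : ι → κ → K, IsNormalizedRep k₀ u w v' := by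
  classical
  obtain ⟨v₁, h₁, he₁⟩ := h.exists_coordinates (Pi.basisFun F κ) (by simpa using he)
  have hzero : ∀ i k, v₁ i k = 0 ↔ w i k = 0 := fun i k => by
    simpa using (h₁.repr_eq_zero_iff (Pi.basisFun F κ) (Pi.basisFun K κ) (by simpa using he)
      (by simpa using he₁) i k).symm
  have hu₁ : ∀ k, v₁ u k ≠ 0 := fun k => by simp [hzero, hu]
  let d : κ → Kˣ := fun k => (Units.mk0 _ (hu₁ k))⁻¹
  let s : ι → Kˣ := fun i =>
    if hi : v₁ i k₀ = 0 then 1 else Units.mk0 (v₁ u k₀ / v₁ i k₀) (div_ne_zero (hu₁ k₀) hi)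
  let T : (κ → K) ≃ₗ[K] κ → K := .piCongrRight fun k => .smulOfUnit (d k)
  have hv' : ∀ i k, (s • (T ∘ v₁)) i k = s i * ((v₁ u k)⁻¹ * v₁ i k) := fun i k => by
    simp only [T, d, Pi.smul_apply', Function.comp_apply, Units.smul_def, Pi.smul_apply,
      LinearEquiv.piCongrRight_apply, smul_eq_mul]
    rfl
  refine ⟨s • (T ∘ v₁), (h₁.map_linearEquiv T).smul_units s, fun i k => ?_, fun i hi => ?_, ?_⟩
  · simp [hv', hu₁, hzero]
  · have hi₁ : v₁ i k₀ ≠ 0 := (hzero i k₀).not.2 hi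
    have := hu₁ k₀
    simp only [hv', s, hi₁, dite_false, Units.val_mk0]
    field_simp
  · ext k
    simp [hv', s, hu₁]

end MatroidEquiv

namespace IsNormalizedRep

variable {ι F K : Type*} [Field F] [Field K] {w : ι → Fin 3 → F} {v : ι → Fin 3 → K}
  {u o d i j l : ι}

theorem eq_one_of_eq_one (h : IsNormalizedRep 2 u w v) (hi : w i 2 = 1) : v i 2 = 1 :=
  h.eq_one i (by simp [hi])

theorem collinear_of_collinear (h : IsNormalizedRep 2 u w v) (hi : w i 2 = 1) (hj : w j 2 = 1)
    (hl : w l 2 = 1)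
    (hw : (w i 0 - w l 0) * (w j 1 - w l 1) = (w i 1 - w l 1) * (w j 0 - w l 0)) :
    (v i 0 - v l 0) * (v j 1 - v l 1) = (v i 1 - v l 1) * (v j 0 - v l 0) := by
  have hdet := h.matroidEquiv.det_eq_zero_iff ![i, j, l]
  simp only [Matrix.det_fin_three, Matrix.of_apply, Function.comp_apply, Matrix.cons_val, hi, hj,
    hl, h.eq_one_of_eq_one hi, h.eq_one_of_eq_one hj, h.eq_one_of_eq_one hl] at hdet
  linear_combination hdet.1 (by linear_combination hw)

theorem parallel_of_parallel (h : IsNormalizedRep 2 u w v) (hi : w i 2 = 1) (hj : w j 2 = 1)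
    (hd : w d 2 = 0) (hw : (w i 0 - w j 0) * w d 1 = (w i 1 - w j 1) * w d 0) :
    (v i 0 - v j 0) * v d 1 = (v i 1 - v j 1) * v d 0 := by
  have hdet := h.matroidEquiv.det_eq_zero_iff ![i, j, d]
  simp only [Matrix.det_fin_three, Matrix.of_apply, Function.comp_apply, Matrix.cons_val, hi, hj,
    hd, h.eq_one_of_eq_one hi, h.eq_one_of_eq_one hj, (h.eq_zero_iff d 2).2 hd] at hdet
  linear_combination -hdet.1 (by linear_combination -hw)

theorem horizontal (h : IsNormalizedRep 2 u w v) (hd : w d = ![1, 0, 0]) (hi : w i 2 = 1)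
    (hj : w j 2 = 1) (hij : w i 1 = w j 1) : v i 1 = v j 1 := by
  have hpar := h.parallel_of_parallel hi hj (d := d) (by simp [hd]) (by simp [hd, hij])
  have hd₀ : v d 0 ≠ 0 := by simp [h.eq_zero_iff, hd]
  have hd₁ : v d 1 = 0 := by simp [h.eq_zero_iff, hd]
  simpa [hd₀, hd₁, sub_eq_zero] using hpar.symm

theorem vertical (h : IsNormalizedRep 2 u w v) (hd : w d = ![0, 1, 0]) (hi : w i 2 = 1)
    (hj : w j 2 = 1) (hij : w i 0 = w j 0) : v i 0 = v j 0 := by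
  have hpar := h.parallel_of_parallel hi hj (d := d) (by simp [hd]) (by simp [hd, hij])
  have hd₀ : v d 0 = 0 := by simp [h.eq_zero_iff, hd]
  have hd₁ : v d 1 ≠ 0 := by simp [h.eq_zero_iff, hd]
  simpa [hd₀, hd₁, sub_eq_zero] using hpar

theorem diagonal (h : IsNormalizedRep 2 u w v) (hu : w u = 1) (ho : w o = ![0, 0, 1])
    (hd : w d = ![1, 1, 0]) (hi : w i 2 = 1) (hj : w j 2 = 1)
    (hij : w i 0 - w j 0 = w i 1 - w j 1) : v i 0 - v j 0 = v i 1 - v j 1 := by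
  have hd₂ : w d 2 = 0 := by simp [hd]
  have hd₀ : v d 0 ≠ 0 := by simp [h.eq_zero_iff, hd]
  have hvo : v o 0 = 0 ∧ v o 1 = 0 := by simp [h.eq_zero_iff, ho]
  have hslope : v d 1 = v d 0 := by
    simpa [h.unit_eq_one, hvo] using
      h.parallel_of_parallel (i := u) (j := o) (by simp [hu]) (by simp [ho]) hd₂
        (by simp [hu, ho, hd])
  have hpar := h.parallel_of_parallel hi hj hd₂ (by simp [hd, hij])
  rw [hslope] at hpar
  exact mul_right_cancel₀ hd₀ hpar

end IsNormalizedRep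

/-- The labels of the points of a von Staudt chain with `m` doubling steps: three points at
infinity, the origin, the centre `focus` of the doublings, a point `scale` fixing their ratio, and
the points of the chain, which lie alternately on the lines `y = 1` and `y = 0`. -/
inductive ChainPoint (m : ℕ)
  | xInf | yInf | diagInf | origin | focus | scale
  | upper (i : Fin (m + 1))
  | lower (i : Fin (m + 1))

namespace ChainPoint

variable {m n N : ℕ}

/-- An enumeration of the points, giving an upper bound for their number. -/
def index : ChainPoint m → ℕ
  | xInf => 0
  | yInf => 1
  | diagInf => 2
  | origin => 3
  | focus => 4
  | scale => 5
  | upper i => 2 * i + 6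
  | lower i => 2 * i + 7

theorem index_lt (P : ChainPoint m) : P.index < 2 * m + 8 := by
  cases P <;> simp only [index] <;> omega

theorem index_injective : Function.Injective (index (m := m)) := by
  intro P Q h
  cases P <;> cases Q <;> simp only [index] at h <;>
    first | rfl | omega | (congr 1; omega)

/-- The enumeration of the points as an embedding into any large enough initial segment. -/
def embedding (hn : 2 * m + 8 ≤ n) : ChainPoint m ↪ Fin n where
  toFun P := ⟨P.index, P.index_lt.trans_le hn⟩
  inj' _ _ h := index_injective (Fin.mk.inj h)

/-- Homogeneous coordinates `(x, y, 1)` of the von Staudt chain of `N`. The abscissa of `upper i`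
is the number whose binary expansion is that of `N` without its last `i + 1` digits, and that of
`lower i` is twice as large. When `N` has `m + 2` digits, `upper (Fin.last m)` is `(1, 1, 1)`. -/
def coord (F : Type*) [Field F] (N : ℕ) : ChainPoint m → Fin 3 → F
  | xInf => ![1, 0, 0]
  | yInf => ![0, 1, 0]
  | diagInf => ![1, 1, 0]
  | origin => ![0, 0, 1]
  | focus => ![0, 2, 1]
  | scale => ![2, 1, 1]
  | upper i => ![(N / 2 ^ (i + 1 : ℕ) : ℕ), 1, 1]
  | lower i => ![2 * (N / 2 ^ (i + 1 : ℕ) : ℕ), 0, 1]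

variable {F K : Type*} [Field F] [Field K] {v : ChainPoint m → Fin 3 → K}

theorem coord_upper_last (hN : N / 2 ^ (m + 1) = 1) : coord F N (upper (Fin.last m)) = 1 := by
  ext k
  fin_cases k <;> simp [coord, hN]

theorem coord_lower_zero (hN : Even N) (hNF : (N : F) = 1) :
    coord F N (lower (0 : Fin (m + 1))) 0 = 1 := by
  have h2 : 2 * (N / 2) = N := Nat.two_mul_div_two_of_even hN
  simp only [coord, Matrix.cons_val_zero, Fin.val_zero, zero_add, pow_one]
  exact_mod_cast h2 ▸ hNF

theorem upper_y (h : IsNormalizedRep 2 (upper (Fin.last m)) (coord F N) v) (i : Fin (m + 1)) :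
    v (upper i) 1 = 1 :=
  (h.horizontal (d := xInf) (i := upper i) (j := upper (Fin.last m)) rfl rfl rfl rfl).trans
    (congrFun h.unit_eq_one 1)

theorem lower_y (h : IsNormalizedRep 2 (upper (Fin.last m)) (coord F N) v) (i : Fin (m + 1)) :
    v (lower i) 1 = 0 :=
  (h.eq_zero_iff _ _).2 rfl

theorem lower_zero_x (h : IsNormalizedRep 2 (upper (Fin.last m)) (coord F N) v)
    (hN : N / 2 ^ (m + 1) = 1) (hN2 : Even N) (hNF : (N : F) = 1) : v (lower 0) 0 = 1 :=
  (h.vertical (d := yInf) (j := upper (Fin.last m)) rfl rfl rfl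
    (by rw [coord_lower_zero hN2 hNF, coord_upper_last hN, Pi.one_apply])).trans
    (congrFun h.unit_eq_one 0)

theorem lower_last_x (h : IsNormalizedRep 2 (upper (Fin.last m)) (coord F N) v)
    (hN : N / 2 ^ (m + 1) = 1) (hN2 : Even N) (hNF : (N : F) = 1) :
    v (lower (Fin.last m)) 0 = 2 := by
  have hscale_y : v scale 1 = 1 :=
    (h.horizontal (d := xInf) (i := scale) (j := upper 0) rfl rfl rfl rfl).trans (upper_y h 0)
  have hscale : v scale 0 - v (lower 0) 0 = v scale 1 - v (lower 0) 1 :=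
    h.diagonal (d := diagInf) (o := origin) (coord_upper_last hN) rfl rfl rfl rfl
      (by rw [coord_lower_zero hN2 hNF]; norm_num [coord])
  have hvert : v (lower (Fin.last m)) 0 = v scale 0 :=
    h.vertical (d := yInf) rfl rfl rfl (by simp [coord, hN])
  rw [lower_zero_x h hN hN2 hNF, lower_y h, hscale_y] at hscale
  linear_combination hvert + hscale

theorem lower_x_mul (h : IsNormalizedRep 2 (upper (Fin.last m)) (coord F N) v)
    (i : Fin (m + 1)) : v (lower i) 0 * (v focus 1 - 1) = v (upper i) 0 * v focus 1 := by
  have hfocus : v focus 0 = 0 := (h.eq_zero_iff _ _).2 rfl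
  have hline := h.collinear_of_collinear (i := lower i) (j := upper i) (l := focus) rfl rfl rfl
    (by simp only [coord, Matrix.cons_val]; ring)
  rw [hfocus, lower_y h, upper_y h] at hline
  linear_combination -hline

theorem lower_x (h : IsNormalizedRep 2 (upper (Fin.last m)) (coord F N) v)
    (hN : N / 2 ^ (m + 1) = 1) (hN2 : Even N) (hNF : (N : F) = 1) (i : Fin (m + 1)) :
    v (lower i) 0 = 2 * v (upper i) 0 := by
  have hfocus : v focus 1 = 2 := by
    have hlast := lower_x_mul h (Fin.last m)
    rw [lower_last_x h hN hN2 hNF, h.unit_eq_one, Pi.one_apply] at hlast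
    linear_combination hlast
  have hi := lower_x_mul h i
  rw [hfocus] at hi
  linear_combination hi

theorem upper_castSucc_x (h : IsNormalizedRep 2 (upper (Fin.last m)) (coord F N) v)
    (hN : N / 2 ^ (m + 1) = 1) (i : Fin m) :
    v (upper i.castSucc) 0 = v (lower i.succ) 0 + ((N / 2 ^ (i + 1 : ℕ)) % 2 : ℕ) := by
  have hdiv : (N / 2 ^ (i + 1 : ℕ) : ℕ) =
      2 * (N / 2 ^ (i + 1 + 1 : ℕ)) + (N / 2 ^ (i + 1 : ℕ)) % 2 := by
    rw [pow_succ 2 (i + 1 : ℕ), ← Nat.div_div_eq_div_mul, Nat.div_add_mod]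
  have hw : coord F N (upper i.castSucc) 0 =
      coord F N (lower i.succ) 0 + ((N / 2 ^ (i + 1 : ℕ)) % 2 : ℕ) := by
    simp only [coord, Matrix.cons_val_zero, Fin.val_castSucc, Fin.val_succ]
    exact_mod_cast congrArg (Nat.cast (R := F)) hdiv
  obtain hbit | hbit := Nat.mod_two_eq_zero_or_one (N / 2 ^ (i + 1 : ℕ))
  · rw [hbit, Nat.cast_zero, add_zero] at hw ⊢
    exact h.vertical (d := yInf) rfl rfl rfl hw
  · rw [hbit, Nat.cast_one] at hw ⊢
    have hdiag := h.diagonal (o := origin) (d := diagInf) (i := upper i.castSucc)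
      (j := lower i.succ) (coord_upper_last hN) rfl rfl rfl rfl (by rw [hw]; simp [coord])
    rw [upper_y h, lower_y h] at hdiag
    linear_combination hdiag

theorem upper_x (h : IsNormalizedRep 2 (upper (Fin.last m)) (coord F N) v)
    (hN : N / 2 ^ (m + 1) = 1) (hN2 : Even N) (hNF : (N : F) = 1) (i : Fin (m + 1)) :
    v (upper i) 0 = (N / 2 ^ (i + 1 : ℕ) : ℕ) := by
  induction i using Fin.reverseInduction with
  | last => rw [h.unit_eq_one, Fin.val_last, hN, Pi.one_apply, Nat.cast_one]
  | cast i ih =>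
    rw [upper_castSucc_x h hN, lower_x h hN hN2 hNF, ih, Fin.val_castSucc, Fin.val_succ,
      pow_succ 2 (i + 1 : ℕ), ← Nat.div_div_eq_div_mul]
    exact_mod_cast congrArg (Nat.cast (R := K)) (Nat.div_add_mod (N / 2 ^ (i + 1 : ℕ)) 2)

theorem natCast_eq_one_of_isNormalizedRep
    (h : IsNormalizedRep 2 (upper (Fin.last m)) (coord F N) v) (hN : N / 2 ^ (m + 1) = 1)
    (hN2 : Even N) (hNF : (N : F) = 1) : (N : K) = 1 :=
  calc (N : K) = 2 * (N / 2 : ℕ) := by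
        exact_mod_cast congrArg Nat.cast (Nat.two_mul_div_two_of_even hN2).symm
    _ = 2 * v (upper 0) 0 := by rw [upper_x h hN hN2 hNF, Fin.val_zero, zero_add, pow_one]
    _ = v (lower 0) 0 := (lower_x h hN hN2 hNF 0).symm
    _ = 1 := lower_zero_x h hN hN2 hNF

theorem natCast_eq_one_of_matroidEquiv {W : Type*} [AddCommGroup W] [Module K W]
    {v : ChainPoint m → W} (h : MatroidEquiv F K (coord F N) v) (hN : N / 2 ^ (m + 1) = 1)
    (hN2 : Even N) (hNF : (N : F) = 1) : (N : K) = 1 := by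
  have hframe : ∀ k, coord F N (![xInf, yInf, origin] k : ChainPoint m) = Pi.single k 1 := by
    intro k
    ext l
    fin_cases k <;> fin_cases l <;> simp [coord]
  obtain ⟨v', hv'⟩ := h.exists_isNormalizedRep hframe 2 (coord_upper_last hN)
  exact natCast_eq_one_of_isNormalizedRep hv' hN hN2 hNF

end ChainPoint

section VectorMatroid

variable {α F V : Type*} [Field F] [AddCommGroup V] [Module F V]

theorem exists_linearIndepOn_insert_of_encard_lt {w : α → V} {I J : Set α}
    (hI : LinearIndepOn F w I) (hJ : LinearIndepOn F w J) (hIJ : I.encard < J.encard) :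
    ∃ e ∈ J, e ∉ I ∧ LinearIndepOn F w (insert e I) := by
  by_contra! hmax
  have hspan : span F (w '' J) ≤ span F (w '' I) := by
    rw [span_le, Set.image_subset_iff]
    intro e he
    by_contra hne
    exact hmax e he (fun heI => hne (subset_span ⟨e, heI, rfl⟩)) (hI.insert hne)
  have hrank : J.encard ≤ I.encard := by
    simpa [toENat_rank_span_set, hI, hJ, hI.injOn.encard_image] using
      Cardinal.toENat.monotone' (Submodule.rank_mono hspan)
  exact hrank.not_gt hIJ

variable (F) in
/-- The matroid on the index type of a family of vectors whose independent sets are the index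
sets of the linearly independent subfamilies. -/
def vectorMatroid (w : α → V) : Matroid α :=
  (IndepMatroid.ofFinitaryCardAugment Set.univ (LinearIndepOn F w)
    (linearIndepOn_empty F w) (fun _ _ hJ hIJ => hJ.mono hIJ)
    (fun I J hI hIfin hJ hJfin hIJ => exists_linearIndepOn_insert_of_encard_lt hI hJ <| by
      rwa [← hIfin.cast_ncard_eq, ← hJfin.cast_ncard_eq, Nat.cast_lt])
    (fun I hI => linearIndepOn_of_finite I hI) (fun I _ => I.subset_univ)).matroid

theorem vectorMatroid_ground (w : α → V) : (vectorMatroid F w).E = Set.univ := rfl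

theorem vectorMatroid_indep_iff {w : α → V} {I : Set α} :
    (vectorMatroid F w).Indep I ↔ LinearIndepOn F w I := Iff.rfl

end VectorMatroid

section Characteristic

variable {α F : Type*} [Field F] {r : ℕ}

theorem vectorMatroid_representableOver (w : α → Fin r → F) :
    MatroidRepresentableOver (vectorMatroid F w) F :=
  ⟨r, w, fun _ _ => vectorMatroid_indep_iff⟩

theorem two_le_of_mem_positiveCharSet {M : Matroid α} {q : ℕ}
    (hq : q ∈ positiveCharSet.{u} M) : 2 ≤ q := by
  obtain ⟨hpos, K, _, _, -⟩ := hq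
  have := CharP.char_ne_one K q
  lia

theorem leastPosChar_vectorMatroid_le {n : ℕ} {F : Type u} [Field F] (w : Fin n → Fin r → F) :
    leastPosChar.{u} (vectorMatroid F w) ≤ maxLeastPosChar.{u} n :=
  (isGreatest_maxLeastPosChar n).2
    ⟨_, vectorMatroid_ground w, ⟨F, inferInstance, vectorMatroid_representableOver w⟩, rfl⟩

theorem leastPosChar_vectorMatroid_mem {p : ℕ} (hp : 0 < p) {F : Type u} [Field F] [CharP F p]
    (w : α → Fin r → F) :
    leastPosChar.{u} (vectorMatroid F w) ∈ positiveCharSet.{u} (vectorMatroid F w) :=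
  Nat.sInf_mem ⟨p, hp, F, inferInstance, inferInstance, vectorMatroid_representableOver w⟩

theorem two_le_maxLeastPosChar (n : ℕ) : 2 ≤ maxLeastPosChar.{u} n :=
  let w : Fin n → Fin 0 → ULift.{u} (ZMod 2) := 0
  (two_le_of_mem_positiveCharSet (leastPosChar_vectorMatroid_mem two_pos w)).trans
    (leastPosChar_vectorMatroid_le w)

theorem prime_le_maxLeastPosChar_of_matroidEquiv {ι : Type*} {n p : ℕ} (hp : p.Prime)
    {F : Type u} [Field F] [CharP F p] (w : ι → Fin r → F) (g : ι ↪ Fin n)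
    (hw : ∀ (K : Type u) [Field K] (s : ℕ) (v : ι → Fin s → K), MatroidEquiv F K w v →
      (p : K) = 0) : p ≤ maxLeastPosChar.{u} n := by
  let w' : Fin n → Fin r → F := Function.extend g w 0
  obtain ⟨-, K, _, _, s, v, hv⟩ := leastPosChar_vectorMatroid_mem hp.pos w'
  have hequiv : MatroidEquiv F K w (v ∘ g) := by
    have h : MatroidEquiv F K w' v := fun I => hv I I.subset_univ
    have hw' : w' ∘ g = w := Function.extend_comp g.injective w 0
    exact hw' ▸ h.comp g.injective
  have hdvd : leastPosChar.{u} (vectorMatroid F w') ∣ p :=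
    (CharP.cast_eq_zero_iff K _ p).1 (hw K s _ hequiv)
  rw [← (hp.eq_one_or_self_of_dvd _ hdvd).resolve_left (CharP.char_ne_one K _)]
  exact leastPosChar_vectorMatroid_le w'

end Characteristic

theorem prime_le_maxLeastPosChar {m n p : ℕ} (hp : p.Prime) (hp2 : p ≠ 2)
    (hpm : (p + 1) / 2 ^ (m + 1) = 1) (hn : 2 * m + 8 ≤ n) : p ≤ maxLeastPosChar.{u} n := by
  have : Fact p.Prime := ⟨hp⟩
  let w : ChainPoint m → Fin 3 → ULift.{u} (ZMod p) := ChainPoint.coord _ (p + 1)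
  refine prime_le_maxLeastPosChar_of_matroidEquiv hp w (ChainPoint.embedding hn)
    fun K _ s v hv => ?_
  have hK : ((p + 1 : ℕ) : K) = 1 :=
    ChainPoint.natCast_eq_one_of_matroidEquiv hv hpm (hp.odd_of_ne_two hp2).add_one (by simp)
  simpa using hK

theorem two_pow_le_maxLeastPosChar {m n : ℕ} (hm : 1 ≤ m) (hn : 2 * m + 8 ≤ n) :
    2 ^ (m + 1) ≤ maxLeastPosChar.{u} n := by
  have h4 : 2 ^ 2 ≤ 2 ^ (m + 1) := Nat.pow_le_pow_right two_pos (by lia)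
  obtain ⟨p, hp, hlt, hle⟩ := Nat.exists_prime_lt_and_le_two_mul (2 ^ (m + 1) - 1) (by lia)
  have hdiv : (p + 1) / 2 ^ (m + 1) = 1 := Nat.div_eq_of_lt_le (by lia) (by lia)
  exact le_trans (by lia) (prime_le_maxLeastPosChar hp (by lia) hdiv hn)

theorem natCast_le_logb_of_pow_le {b k c : ℕ} (hb : 1 < b) (h : b ^ k ≤ c) :
    (k : ℝ) ≤ Real.logb b c :=
  (Nat.cast_le.2 (Nat.le_log_of_pow_le hb h)).trans (Real.natLog_le_logb c b)

theorem theorem4p1 (n : ℕ) (hn : 1 ≤ n) :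
    Real.logb 2 (maxLeastPosChar.{u} n : ℝ) ≥ ((n : ℝ) - 7) / 2 := by
  obtain ⟨k, hnk, hk⟩ : ∃ k, n ≤ 2 * k + 7 ∧ 2 ^ k ≤ maxLeastPosChar.{u} n := by
    obtain hsmall | hlarge := le_or_gt n 9
    · exact ⟨1, by lia, two_le_maxLeastPosChar n⟩
    · exact ⟨(n - 8) / 2 + 1, by lia, two_pow_le_maxLeastPosChar (by lia) (by lia)⟩
  have hnk' : (n : ℝ) ≤ 2 * k + 7 := mod_cast hnk
  calc ((n : ℝ) - 7) / 2 ≤ k := by linarith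
    _ ≤ Real.logb 2 (maxLeastPosChar.{u} n) := natCast_le_logb_of_pow_le one_lt_two hk
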